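/- **Theorem 4.3.** Let $(\mathbf{x}_t)_{t\ge 0}$ be a sequence of random vectors in $\mathbb{R}^d$ and $(e_t)_{t\ge 0}$ a sequence of real random variables on a probability space, and suppose the following. (a) The sequences $(\mathbf{x}_t)$ and $(e_t)$ are independent. The sequence $(\mathbf{x}_t)$ is stationary and ergodic, with square integrable coordinates, and there are $c>0$, $\zeta>2$ with $|\mathrm{cov}(\mathbf{x}_0(i),\mathbf{x}_t(i))|\le c(t+1)^{-\zeta}$ for all $t\ge 0$ and $1\le i\le d$, where $\mathbf{x}_t(i)$ is the $i$th coordinate of $\mathbf{x}_t$. The $e_t$ are square integrable, $Ee_0=0$, and there are $c>0$, $\zeta>2$ with $|Ee_te_s|\le c(|t-s|+1)^{-\zeta}$ for all $t,s\ge 0$. (b) The matrix $\mathbf{C}_z=E\,\mathbf{x}_0\mathbf{x}_0^\top$ is nonsingular. Write $\bar{\mathbf{x}}_0=E\,\mathbf{x}_0$. (c) There are $\sigma>0$, $0<\kappa<1/2$ and, for every $T$, independent Wiener processes $W_{T,1}$, $W_{T,2}$ such that, as $T\to\infty$, $$\sup_{1\le x\le T/2}x^{-\kappa}\Big|\sum_{s=1}^{\lfloor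 x\rfloor}e_s-\sigma W_{T,1}(x)\Big|=O_P(1),\qquad \sup_{T/2\le x\le T-1}(T-x)^{-\kappa}\Big|\sum_{s=\lfloor x\rfloor+1}^{T}e_s-\sigma W_{T,2}(T-x)\Big|=O_P(1).$$ (d) The trimming parameters $t_T\in\mathbb{R}$ satisfy $t_T\to\infty$ and $t_T/T\to0$ as $T\to\infty$. For each sample size $T$ we observe $(\mathbf{x}_t,X_t)$, $1\le t\le T$, with $X_t=\mathbf{x}_t^\top\boldsymbol\beta_t+e_t$ and a single change: for all large $T$ there is $t^*=t^*_T$ with $1<t^*<T$ such that $\boldsymbol\beta_t=\boldsymbol\beta_{(1)}$ for $t\le t^*$ and $\boldsymbol\beta_t=\boldsymbol\beta_{(2)}$ for $t>t^*$, where $\boldsymbol\beta_{(1)}\ne\boldsymbol\beta_{(2)}$ are nonrandom and may depend on $T$. Assume that $t_T\le t^*\le T-t_T$ for all large $T$, that $$t_T^{1/2}\,\big|\bar{\mathbf{x}}_0^\top(\boldsymbol\beta_{(1)}-\boldsymbol\beta_{(2)})\big|\to\infty ,$$ and that $$\|\boldsymbol\beta_{(1)}-\boldsymbol\beta_{(2)}\|=o\Big(t_T^{1/2}\,\big|\bar{\mathbf{x}}_0^\top(\boldsymbol\beta_{(1)}-\boldsymbol\beta_{(2)})\big|\Big).$$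 (The last condition follows from the previous one whenever $\|\boldsymbol\beta_{(1)}-\boldsymbol\beta_{(2)}\|$ is bounded in $T$, thus for fixed and for shrinking changes.) Let $\hat e_t=X_t-\mathbf{x}_t^\top\hat{\boldsymbol\beta}_T$, where $\hat{\boldsymbol\beta}_T=(\mathbf{Z}_T^\top\mathbf{Z}_T)^{-1}\mathbf{Z}_T^\top(X_1,\dots,X_T)^\top$ is the least squares estimator and $\mathbf{Z}_T=[\mathbf{x}_1,\dots,\mathbf{x}_T]^\top$ (with any fixed measurable convention, such as replacing the inverse by $0$, if $\mathbf{Z}_T^\top\mathbf{Z}_T$ is singular). Then, as $T\to\infty$, $$t_T^{1/2}\max_{t_T\le t\le T-t_T}\left|\frac1t\sum_{s=1}^t\hat e_s-\frac1{T-t}\sum_{s=t+1}^T\hat e_s\right|\ \stackrel{P}{\longrightarrow}\ \infty ,$$ the maximum being over integers $t$. Consequently the test that rejects when $\sigma^{-1}$ times the left-hand side exceeds a fixed critical value $q$ is consistent: for every $q\in\mathbb{R}$ its rejection probability tends to $1$. -/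

import Mathlib

open MeasureTheory ProbabilityTheory Filter Topology Asymptotics
open scoped NNReal ENNReal Matrix

noncomputable section

namespace RenyiRegression

variable {Ω : Type*} [MeasurableSpace Ω] {d : ℕ}

/-- The left shift on one-sided sequences of vectors in `ℝ^d`. -/
def shift (y : ℕ → Fin d → ℝ) : ℕ → Fin d → ℝ := fun t => y (t + 1)

/-- The sequence `x 0, x 1, …` is stationary and ergodic: its law on the sequence space is invariant
and ergodic under the shift. (`Ergodic` in Mathlib contains `MeasurePreserving`.) -/
def StationaryErgodic (P : Measure Ω) (x : ℕ → Ω → Fin d → ℝ) : Prop :=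
  Ergodic (shift (d := d)) (P.map (fun ω t => x t ω))

/-- `x̄₀`, the almost sure limit of `(1/t) ∑_{s=1}^t x_s`, which is the mean vector `E x_0`. -/
def meanVec (P : Measure Ω) (x : ℕ → Ω → Fin d → ℝ) : Fin d → ℝ :=
  fun i => ∫ ω, x 0 ω i ∂P

/-- `C_z`, the almost sure limit of `(1/T) ZᵀZ`, which is the second moment matrix `E (x_0 x_0ᵀ)`. -/
def momentMatrix (P : Measure Ω) (x : ℕ → Ω → Fin d → ℝ) : Matrix (Fin d) (Fin d) ℝ :=
  Matrix.of fun i j => ∫ ω, x 0 ω i * x 0 ω j ∂P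

/-- The trimming parameter tends to infinity, more slowly than the sample size. -/
def TrimmingAssumption (trim : ℕ → ℝ) : Prop :=
  Tendsto trim atTop atTop ∧ Tendsto (fun T : ℕ => trim T / T) atTop (𝓝 0)

/-- Gaussian approximation of the partial sums of the errors from both ends of the sample.
For every `T` there are independent Wiener processes `W₁ T`, `W₂ T` such that, for some
`0 < κ < 1/2`, the two weighted suprema are bounded in probability as `T → ∞`. The event
that a supremum exceeds `M` is written out as the event that some `x` does. -/
def ApproximationAssumption (P : Measure Ω) (e : ℕ → Ω → ℝ) (σ : ℝ) : Prop :=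
  0 < σ ∧ ∃ κ : ℝ, 0 < κ ∧ κ < 1 / 2 ∧ ∃ W₁ W₂ : ℕ → ℝ≥0 → Ω → ℝ,
    (∀ T, IsBrownianReal (W₁ T) P ∧ IsBrownianReal (W₂ T) P ∧
      IndepFun (fun ω u => W₁ T u ω) (fun ω u => W₂ T u ω) P) ∧
    (∀ ε : ℝ≥0∞, 0 < ε → ∃ M : ℝ, ∀ᶠ T : ℕ in atTop,
      P {ω | ∃ x : ℝ, 1 ≤ x ∧ x ≤ (T : ℝ) / 2 ∧
        M < x ^ (-κ) * |∑ s ∈ Finset.Icc 1 ⌊x⌋₊, e s ω - σ * W₁ T x.toNNReal ω|} ≤ ε) ∧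
    (∀ ε : ℝ≥0∞, 0 < ε → ∃ M : ℝ, ∀ᶠ T : ℕ in atTop,
      P {ω | ∃ x : ℝ, (T : ℝ) / 2 ≤ x ∧ x ≤ (T : ℝ) - 1 ∧
        M < ((T : ℝ) - x) ^ (-κ) *
          |∑ s ∈ Finset.Icc (⌊x⌋₊ + 1) T, e s ω - σ * W₂ T ((T : ℝ) - x).toNNReal ω|} ≤ ε)

/-- The regressors `x_t` and the errors `e_t`: independent sequences; the regressors are stationary
and ergodic with autocovariances of order `t^{-ζ}`, the errors have `E e_0 = 0` and product moments
of order `|t-s|^{-ζ}`, where `ζ > 2`. The `MemLp` fields say that these moments exist. -/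
structure DependenceAssumption (P : Measure Ω) (x : ℕ → Ω → Fin d → ℝ) (e : ℕ → Ω → ℝ) :
    Prop where
  measurable_x : ∀ t, Measurable (x t)
  measurable_e : ∀ t, Measurable (e t)
  indep : IndepFun (fun ω t => x t ω) (fun ω t => e t ω) P
  stationaryErgodic : StationaryErgodic P x
  memLp_x : ∀ i, MemLp (fun ω => x 0 ω i) 2 P
  cov_x : ∃ c ζ : ℝ, 0 < c ∧ 2 < ζ ∧ ∀ (i : Fin d) (t : ℕ),
    |cov[fun ω => x 0 ω i, fun ω => x t ω i; P]| ≤ c * ((t : ℝ) + 1) ^ (-ζ)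
  memLp_e : ∀ t, MemLp (e t) 2 P
  mean_e : ∫ ω, e 0 ω ∂P = 0
  moment_e : ∃ c ζ : ℝ, 0 < c ∧ 2 < ζ ∧ ∀ t s : ℕ,
    |∫ ω, e t ω * e s ω ∂P| ≤ c * (|(t : ℝ) - (s : ℝ)| + 1) ^ (-ζ)

/-- The coefficient vector at time `t` when it changes from `b₁` to `b₂` after time `k`. -/
def coefAt (b₁ b₂ : Fin d → ℝ) (k t : ℕ) : Fin d → ℝ := if t ≤ k then b₁ else b₂

/-- The observation `X_t = x_tᵀ β_t + e_t` in the model with a single change after time `k`. -/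
def response (x : ℕ → Ω → Fin d → ℝ) (e : ℕ → Ω → ℝ) (b₁ b₂ : Fin d → ℝ) (k t : ℕ) (ω : Ω) : ℝ :=
  x t ω ⬝ᵥ coefAt b₁ b₂ k t + e t ω

/-- The design matrix with rows `x_1, …, x_T`. -/
def designMatrix (x : ℕ → Ω → Fin d → ℝ) (T : ℕ) (ω : Ω) : Matrix (Fin T) (Fin d) ℝ :=
  Matrix.of fun s => x ((s : ℕ) + 1) ω

/-- The least squares estimator `(ZᵀZ)⁻¹ Zᵀ X` from the observations `X_1, …, X_T`. -/
def leastSquares (x : ℕ → Ω → Fin d → ℝ) (X : ℕ → Ω → ℝ) (T : ℕ) (ω : Ω) : Fin d → ℝ :=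
  (((designMatrix x T ω)ᵀ * designMatrix x T ω)⁻¹ * (designMatrix x T ω)ᵀ) *ᵥ
    fun s : Fin T => X ((s : ℕ) + 1) ω

/-- The residual at time `t`, based on a sample of size `T`. -/
def residual (x : ℕ → Ω → Fin d → ℝ) (X : ℕ → Ω → ℝ) (T t : ℕ) (ω : Ω) : ℝ :=
  X t ω - x t ω ⬝ᵥ leastSquares x X T ω

/-- The Rényi statistic of a series `r_1, …, r_T` with trimming `τ`: the maximum of
`|(1/t) ∑_{s ≤ t} r_s - (1/(T-t)) ∑_{s > t} r_s|` over the integers `τ ≤ t ≤ T - τ`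
(and `0` if there are none). -/
def renyiStat (r : ℕ → ℝ) (T : ℕ) (τ : ℝ) : ℝ :=
  ((((Finset.range (T + 1)).filter fun t : ℕ => τ ≤ (t : ℝ) ∧ (t : ℝ) ≤ (T : ℝ) - τ).sup fun t =>
    ‖(1 / (t : ℝ)) * ∑ s ∈ Finset.Icc 1 t, r s
      - (1 / ((T : ℝ) - (t : ℝ))) * ∑ s ∈ Finset.Icc (t + 1) T, r s‖₊ : ℝ≥0) : ℝ)

/-- The Rényi statistic of the least squares residuals from a sample of size `T`, with trimming `τ`,
when the coefficients change from `b₁` to `b₂` after time `k`. -/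
def residualRenyi (x : ℕ → Ω → Fin d → ℝ) (e : ℕ → Ω → ℝ) (b₁ b₂ : Fin d → ℝ)
    (k T : ℕ) (τ : ℝ) (ω : Ω) : ℝ :=
  renyiStat (fun t => residual x (response x e b₁ b₂ k) T t ω) T τ

end RenyiRegression

end

/-! The maximum is at least its value at the true change point `t*`. Write `Δ = β₁ - β₂` and `θ` for
the least squares estimate minus `β₂`. Centring the regressors at their mean `m`, the contrast of
the residuals at `t*` becomes `m·Δ + a·Δ - a·θ + b·θ` plus the difference of the two error averages,
where `a`, `b` are the centred regressor averages before and after `t*`; the terms `m·θ` of the two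
halves cancel (`residual_contrast_eq`).

Summable product moments make the second moment of a sum of `n` terms `O(n)`. Each half has at least
`t_T` terms, so `a`, `b` and the error averages are `O_P(t_T^{-1/2})`
(`bddInProb_sqrt_mul_average_split`).

Consistency of the estimator is not needed: `|θ i| ≤ K (‖Δ‖ H + N)` with `H`, `N` bounded in
probability suffices (`abs_leastSquares_sub_le`). It holds as soon as `ZᵀZ / T` is close to the
nonsingular `C_z`, which the mean ergodic theorem gives with probability tending to one.

Hence `√t_T` times the statistic is at least `√t_T |m·Δ| - ‖Δ‖ O_P(1) - O_P(1)`, and the two rate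
conditions on `Δ` make the first term dominate (`tendsto_measure_le_of_lower_bound`). -/

namespace RenyiRegression

/-! ### Mean ergodic theorems in `L²` and `L¹` -/

section Ergodic

variable {α : Type*} [MeasurableSpace α] {μ : Measure α} {τ : α → α}

/-- Mean ergodic theorem in `L²` for an ergodic map, in terms of functions. -/
theorem tendsto_eLpNorm_two_birkhoffAverage [IsProbabilityMeasure μ] (hτ : Ergodic τ μ)
    {f : α → ℝ} (hf : MemLp f 2 μ) :
    Tendsto (fun n : ℕ => eLpNorm
      (fun y => (n : ℝ)⁻¹ * ∑ k ∈ Finset.range n, f (τ^[k] y) - ∫ z, f z ∂μ) 2 μ) atTop (𝓝 0) := by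
  have hmp := hτ.toMeasurePreserving
  -- The Koopman operator, an isometry of `L²`; by von Neumann's theorem its averages converge to
  -- the projection `p` onto its fixed vectors.
  set U : Lp ℝ 2 μ →L[ℝ] Lp ℝ 2 μ :=
    (Lp.compMeasurePreservingₗᵢ ℝ τ hmp).toContinuousLinearMap with hU
  have hU1 : ‖U‖ ≤ 1 := LinearIsometry.norm_toContinuousLinearMap_le _
  set F : Lp ℝ 2 μ := hf.toLp f with hF
  have hlim := U.tendsto_birkhoffAverage_orthogonalProjection hU1 F
  set p := (U.eqLocus (1 : Lp ℝ 2 μ →L[ℝ] Lp ℝ 2 μ)).orthogonalProjectionOnto F with hp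
  have hfk : ∀ k, MemLp (fun y => f (τ^[k] y)) 2 μ := fun k =>
    hf.comp_measurePreserving (hmp.iterate k)
  have hiter : ∀ k, U^[k] F = (hfk k).toLp _ := by
    intro k
    have : (U : Lp ℝ 2 μ → Lp ℝ 2 μ) = Lp.compMeasurePreserving τ hmp := rfl
    rw [this, Lp.compMeasurePreserving_iterate hmp k]
    rfl
  have hsum : ∀ n : ℕ, MemLp (fun y => ∑ k ∈ Finset.range n, f (τ^[k] y)) 2 μ := fun n =>
    memLp_finsetSum _ fun k _ => hfk k
  have hsum' : ∀ n : ℕ, ∑ k ∈ Finset.range n, U^[k] F = (hsum n).toLp _ := by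
    intro n
    induction n with
    | zero =>
      simp only [Finset.range_zero, Finset.sum_empty]
      exact (MemLp.toLp_zero _).symm
    | succ n ih =>
      rw [Finset.sum_range_succ, ih, hiter, ← MemLp.toLp_add]
      apply MemLp.toLp_congr
      filter_upwards with y
      simp [Finset.sum_range_succ]
  -- A fixed vector is an invariant function, so ergodicity makes it constant.
  obtain ⟨c, hc⟩ : ∃ c : ℝ, ((p : Lp ℝ 2 μ) : α → ℝ) =ᵐ[μ] Function.const α c := by
    refine hτ.ae_eq_const_of_ae_eq_comp_ae (Lp.aestronglyMeasurable _) ?_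
    have h1 : U p = p := p.2
    have h2 := Lp.coeFn_compMeasurePreserving (p : Lp ℝ 2 μ) hmp
    have h3 : Lp.compMeasurePreserving τ hmp (p : Lp ℝ 2 μ) = p := h1
    rw [h3] at h2
    exact h2.symm
  have hpc : (p : Lp ℝ 2 μ) = (memLp_const c).toLp (fun _ => c) := by
    apply Lp.ext
    exact hc.trans (MemLp.coeFn_toLp (memLp_const c)).symm
  have hnorm : Tendsto (fun n : ℕ => eLpNorm
      (fun y => (n : ℝ)⁻¹ * ∑ k ∈ Finset.range n, f (τ^[k] y) - c) 2 μ) atTop (𝓝 0) := by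
    have h := (tendsto_iff_norm_sub_tendsto_zero.1 hlim)
    have h' := (ENNReal.continuous_ofReal.tendsto 0).comp h
    simp only [ENNReal.ofReal_zero] at h'
    refine h'.congr fun n => ?_
    have hA : MemLp (fun y => (n : ℝ)⁻¹ * ∑ k ∈ Finset.range n, f (τ^[k] y) - c) 2 μ :=
      ((hsum n).const_mul _).sub (memLp_const c)
    have e1 : birkhoffAverage ℝ U _root_.id n F - (p : Lp ℝ 2 μ) = hA.toLp _ := by
      rw [birkhoffAverage, birkhoffSum]
      simp only [id]
      rw [hsum', hpc]
      rfl
    rw [Function.comp, e1, ofReal_norm, Lp.enorm_toLp]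
  -- Every average has integral `∫ f`, so `|∫ f - c|` is at most an `L²` norm that tends to zero.
  have hce : c = ∫ z, f z ∂μ := by
    have hint : ∀ n : ℕ, 0 < n →
        ∫ y, ((n : ℝ)⁻¹ * ∑ k ∈ Finset.range n, f (τ^[k] y) - c) ∂μ = ∫ z, f z ∂μ - c := by
      intro n hn
      rw [integral_sub (((hsum n).const_mul _).integrable one_le_two) (integrable_const c),
        integral_const_mul, integral_finsetSum _ fun k _ => (hfk k).integrable one_le_two]
      have : ∀ k, ∫ y, f (τ^[k] y) ∂μ = ∫ z, f z ∂μ := fun k => by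
        have hk := hmp.iterate k
        have := integral_map (μ := μ) (φ := τ^[k]) hk.aemeasurable (f := f)
          (by rw [hk.map_eq]; exact hf.1)
        rw [← this, hk.map_eq]
      simp only [this, Finset.sum_const, Finset.card_range, nsmul_eq_mul, integral_const,
        probReal_univ, one_smul]
      field_simp
    have hle : ∀ n : ℕ, 0 < n → ENNReal.ofReal |∫ z, f z ∂μ - c| ≤ eLpNorm
      (fun y => (n : ℝ)⁻¹ * ∑ k ∈ Finset.range n, f (τ^[k] y) - c) 2 μ := by
      intro n hn
      rw [← hint n hn, ← Real.norm_eq_abs, ofReal_norm]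
      refine (enorm_integral_le_lintegral_enorm _).trans ?_
      rw [← eLpNorm_one_eq_lintegral_enorm]
      exact eLpNorm_le_eLpNorm_of_exponent_le one_le_two
        (((hsum n).const_mul _).sub (memLp_const c)).1
    have h0 : ENNReal.ofReal |∫ z, f z ∂μ - c| ≤ 0 :=
      ge_of_tendsto hnorm ((eventually_gt_atTop 0).mono fun n hn => hle n hn)
    have := ENNReal.ofReal_eq_zero.1 (le_antisymm h0 bot_le)
    have := abs_eq_zero.1 (le_antisymm this (abs_nonneg _))
    linarith
  rw [← hce]
  exact hnorm

/-- Mean ergodic theorem in `L¹` for an ergodic map, in terms of functions. -/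
theorem tendsto_eLpNorm_one_birkhoffAverage [IsProbabilityMeasure μ] (hτ : Ergodic τ μ)
    {f : α → ℝ} (hf : Integrable f μ) :
    Tendsto (fun n : ℕ => eLpNorm
      (fun y => (n : ℝ)⁻¹ * ∑ k ∈ Finset.range n, f (τ^[k] y) - ∫ z, f z ∂μ) 1 μ) atTop (𝓝 0) := by
  have hmp := hτ.toMeasurePreserving
  rw [ENNReal.tendsto_nhds_zero]
  intro ε hε
  have hε3 : ε / 3 ≠ 0 := (ENNReal.div_pos hε.ne' (by norm_num)).ne'
  -- A simple function `g` near `f` in `L¹` lies in `L²`. Averaging contracts `L¹`, so replacing `f`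
  -- by `g` costs `ε / 3` in the averages and `ε / 3` in the means.
  obtain ⟨g, hg, hgI, hg2⟩ : ∃ g : α → ℝ, eLpNorm (f - g) 1 μ < ε / 3 ∧ Integrable g μ ∧
      MemLp g 2 μ := by
    obtain ⟨g, hg, hg1⟩ := (memLp_one_iff_integrable.2 hf).exists_simpleFunc_eLpNorm_sub_lt
      (by simp) hε3
    exact ⟨g, hg, memLp_one_iff_integrable.1 hg1, g.memLp_of_isFiniteMeasure 2 μ⟩
  have hlim := ENNReal.tendsto_nhds_zero.1 (tendsto_eLpNorm_two_birkhoffAverage hτ hg2) (ε / 3)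
    (pos_iff_ne_zero.2 hε3)
  filter_upwards [hlim, eventually_gt_atTop 0] with n hn hn0
  have hfg : Integrable (fun y => f y - g y) μ := hf.sub hgI
  have hk : ∀ {h : α → ℝ}, Integrable h μ → ∀ k, Integrable (fun y => h (τ^[k] y)) μ :=
    fun hh k => (hmp.iterate k).integrable_comp_of_integrable hh
  have hs : ∀ {h : α → ℝ}, Integrable h μ →
      Integrable (fun y => (n : ℝ)⁻¹ * ∑ k ∈ Finset.range n, h (τ^[k] y)) μ :=
    fun hh => (integrable_finsetSum _ fun k _ => hk hh k).const_mul _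
  have hdecomp : (fun y => (n : ℝ)⁻¹ * ∑ k ∈ Finset.range n, f (τ^[k] y) - ∫ z, f z ∂μ) =
      ((fun y => (n : ℝ)⁻¹ * ∑ k ∈ Finset.range n, (f (τ^[k] y) - g (τ^[k] y))) +
        fun y => (n : ℝ)⁻¹ * ∑ k ∈ Finset.range n, g (τ^[k] y) - ∫ z, g z ∂μ) +
        fun _ => -∫ z, (f z - g z) ∂μ := by
    funext y
    simp only [Pi.add_apply]
    rw [integral_sub hf hgI, Finset.sum_sub_distrib]
    ring
  have b1 : eLpNorm (fun y => (n : ℝ)⁻¹ * ∑ k ∈ Finset.range n, (f (τ^[k] y) - g (τ^[k] y))) 1 μ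
      ≤ ε / 3 := by
    have e1 : (fun y => (n : ℝ)⁻¹ * ∑ k ∈ Finset.range n, (f (τ^[k] y) - g (τ^[k] y))) =
        (n : ℝ)⁻¹ • ∑ k ∈ Finset.range n, fun y => (f (τ^[k] y) - g (τ^[k] y)) := by
      funext y; simp
    rw [e1, eLpNorm_const_smul]
    have hsum := eLpNorm_sum_le (μ := μ) (p := 1) (s := Finset.range n)
      (f := fun k y => (f (τ^[k] y) - g (τ^[k] y))) (fun k _ => (hk hfg k).1) le_rfl
    have each : ∀ k, eLpNorm (fun y => (f (τ^[k] y) - g (τ^[k] y))) 1 μ = eLpNorm (f - g) 1 μ :=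
      fun k => eLpNorm_comp_measurePreserving (g := f - g) hfg.1 (hmp.iterate k)
    simp only [each, Finset.sum_const, Finset.card_range, nsmul_eq_mul] at hsum
    have hnn : ‖(n : ℝ)⁻¹‖ₑ * (n : ℝ≥0∞) = 1 := by
      have : (0 : ℝ) < n := by exact_mod_cast hn0
      rw [Real.enorm_eq_ofReal (by positivity), ENNReal.ofReal_inv_of_pos this,
        ENNReal.ofReal_natCast]
      exact ENNReal.inv_mul_cancel (by exact_mod_cast hn0.ne') (by simp)
    calc _ ≤ ‖(n : ℝ)⁻¹‖ₑ * (n * eLpNorm (f - g) 1 μ) := by gcongr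
      _ = eLpNorm (f - g) 1 μ := by rw [← mul_assoc, hnn, one_mul]
      _ ≤ ε / 3 := hg.le
  have b2 : eLpNorm (fun y => (n : ℝ)⁻¹ * ∑ k ∈ Finset.range n, g (τ^[k] y) - ∫ z, g z ∂μ) 1 μ
      ≤ ε / 3 :=
    (eLpNorm_le_eLpNorm_of_exponent_le one_le_two ((hs hgI).sub (integrable_const _)).1).trans hn
  have b3 : eLpNorm (fun _ : α => -∫ z, (f z - g z) ∂μ) 1 μ ≤ ε / 3 := by
    rw [eLpNorm_one_eq_lintegral_enorm]
    simp only [enorm_neg, lintegral_const, measure_univ, mul_one]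
    refine (enorm_integral_le_lintegral_enorm _).trans ?_
    rw [← eLpNorm_one_eq_lintegral_enorm]
    exact hg.le
  rw [hdecomp]
  calc _ ≤ ε / 3 + ε / 3 + ε / 3 := by
        refine (eLpNorm_add_le ?_ ?_ le_rfl).trans (add_le_add ((eLpNorm_add_le ?_ ?_ le_rfl).trans
          (add_le_add b1 b2)) b3)
        · exact (hs hfg).1.add ((hs hgI).sub (integrable_const _)).1
        · exact aestronglyMeasurable_const
        · exact (hs hfg).1
        · exact ((hs hgI).sub (integrable_const _)).1
    _ = ε := ENNReal.add_thirds ε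

end Ergodic

/-! ### Calculus of `O_P(1)` -/

section BoundedInProbability

variable {Ω : Type*} [MeasurableSpace Ω] {P : Measure Ω}

/-- `Y_T = O_P(1)` as `T → ∞`. -/
def BddInProb (P : Measure Ω) (Y : ℕ → Ω → ℝ) : Prop :=
  ∀ ε : ℝ≥0∞, 0 < ε → ∃ M : ℝ, 0 ≤ M ∧ ∀ᶠ T in atTop, P {ω | M < |Y T ω|} ≤ ε

theorem BddInProb.of_abs_le {Y Z : ℕ → Ω → ℝ} (hZ : BddInProb P Z)
    (h : ∀ᶠ T in atTop, ∀ ω, |Y T ω| ≤ |Z T ω|) : BddInProb P Y := fun ε hε => by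
  obtain ⟨M, hM0, hM⟩ := hZ ε hε
  refine ⟨M, hM0, ?_⟩
  filter_upwards [hM, h] with T h1 h2
  exact (measure_mono fun ω hω => lt_of_lt_of_le hω (h2 ω)).trans h1

theorem BddInProb.const (c : ℝ) : BddInProb P (fun _ _ => c) := fun ε _ =>
  ⟨|c|, abs_nonneg c, Eventually.of_forall fun T => by simp⟩

theorem BddInProb.add {Y Z : ℕ → Ω → ℝ} (hY : BddInProb P Y) (hZ : BddInProb P Z) :
    BddInProb P (fun T ω => Y T ω + Z T ω) := fun ε hε => by
  obtain ⟨M, hM0, hM⟩ := hY (ε / 2) (ENNReal.half_pos hε.ne')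
  obtain ⟨N, hN0, hN⟩ := hZ (ε / 2) (ENNReal.half_pos hε.ne')
  refine ⟨M + N, by positivity, ?_⟩
  filter_upwards [hM, hN] with T h1 h2
  calc P {ω | M + N < |Y T ω + Z T ω|}
      ≤ P ({ω | M < |Y T ω|} ∪ {ω | N < |Z T ω|}) := by
        refine measure_mono fun ω hω => ?_
        by_contra! hcon
        simp only [Set.mem_union, Set.mem_ofPred_eq, not_or, not_lt] at hcon hω
        linarith [abs_add_le (Y T ω) (Z T ω)]
    _ ≤ ε / 2 + ε / 2 := (measure_union_le _ _).trans (add_le_add h1 h2)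
    _ = ε := ENNReal.add_halves ε

theorem BddInProb.mul {Y Z : ℕ → Ω → ℝ} (hY : BddInProb P Y) (hZ : BddInProb P Z) :
    BddInProb P (fun T ω => Y T ω * Z T ω) := fun ε hε => by
  obtain ⟨M, hM0, hM⟩ := hY (ε / 2) (ENNReal.half_pos hε.ne')
  obtain ⟨N, hN0, hN⟩ := hZ (ε / 2) (ENNReal.half_pos hε.ne')
  refine ⟨M * N, by positivity, ?_⟩
  filter_upwards [hM, hN] with T h1 h2
  calc P {ω | M * N < |Y T ω * Z T ω|}
      ≤ P ({ω | M < |Y T ω|} ∪ {ω | N < |Z T ω|}) := by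
        refine measure_mono fun ω hω => ?_
        by_contra! hcon
        simp only [Set.mem_union, Set.mem_ofPred_eq, not_or, not_lt] at hcon hω
        rw [abs_mul] at hω
        have := mul_le_mul hcon.1 hcon.2 (abs_nonneg _) hM0
        linarith
    _ ≤ ε / 2 + ε / 2 := (measure_union_le _ _).trans (add_le_add h1 h2)
    _ = ε := ENNReal.add_halves ε

theorem BddInProb.sum {ι : Type*} (s : Finset ι) {Y : ι → ℕ → Ω → ℝ}
    (h : ∀ i ∈ s, BddInProb P (Y i)) : BddInProb P (fun T ω => ∑ i ∈ s, Y i T ω) := by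
  classical
  induction s using Finset.induction_on with
  | empty => simpa using BddInProb.const (P := P) 0
  | insert a s ha ih =>
    simp only [Finset.sum_insert ha]
    exact (h a (by simp)).add (ih fun i hi => h i (by simp [hi]))

/-- Markov's inequality. -/
theorem BddInProb.of_integral_le [IsProbabilityMeasure P] {Y : ℕ → Ω → ℝ} (C : ℝ)
    (h : ∀ᶠ T in atTop, Integrable (Y T) P ∧ ∫ ω, |Y T ω| ∂P ≤ C) : BddInProb P Y := by
  intro ε hε
  -- A finite level below `ε`, which may be infinite; `|C| + 1` keeps the threshold positive.
  obtain ⟨δ, hδ, hδε⟩ := ENNReal.lt_iff_exists_nnreal_btwn.1 hε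
  have hδ0 : (0 : ℝ) < δ := by exact_mod_cast hδ
  refine ⟨(|C| + 1) / δ, by positivity, ?_⟩
  filter_upwards [h] with T hT
  have hM : (0 : ℝ) < (|C| + 1) / δ := by positivity
  have h1 := mul_meas_ge_le_integral_of_nonneg (μ := P) (f := fun ω => |Y T ω|)
    (ae_of_all _ fun ω => abs_nonneg _) hT.1.abs ((|C| + 1) / δ)
  have h2 : P.real {ω | (|C| + 1) / δ ≤ |Y T ω|} ≤ δ := by
    rw [← mul_le_mul_iff_right₀ hM]
    calc _ ≤ C := h1.trans hT.2
      _ ≤ |C| + 1 := by linarith [le_abs_self C]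
      _ = (|C| + 1) / δ * δ := by field_simp
  calc P {ω | (|C| + 1) / δ < |Y T ω|} ≤ P {ω | (|C| + 1) / δ ≤ |Y T ω|} :=
        measure_mono fun ω hω => by
          simp only [Set.mem_ofPred_eq] at hω ⊢; exact hω.le
    _ ≤ δ := by
      rw [← ENNReal.ofReal_coe_nnreal]
      exact (ENNReal.le_ofReal_iff_toReal_le (measure_ne_top _ _) δ.2).2 h2
    _ ≤ ε := hδε.le

/-- Reduces to the first-moment bound through `|Y| ≤ 1 + Y ^ 2`. -/
theorem BddInProb.of_integral_sq_le [IsProbabilityMeasure P] {Y : ℕ → Ω → ℝ} (C : ℝ)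
    (h : ∀ᶠ T in atTop, MemLp (Y T) 2 P ∧ ∫ ω, Y T ω ^ 2 ∂P ≤ C) : BddInProb P Y := by
  have h1 : BddInProb P (fun T ω => Y T ω ^ 2) := by
    refine BddInProb.of_integral_le C ?_
    filter_upwards [h] with T hT
    exact ⟨hT.1.integrable_sq, by simpa using hT.2⟩
  refine ((BddInProb.const 1).add h1).of_abs_le (Eventually.of_forall fun T ω => ?_)
  rw [abs_of_nonneg (by positivity : 0 ≤ 1 + Y T ω ^ 2), ← sq_abs]
  nlinarith [sq_nonneg (|Y T ω| - 1), abs_nonneg (Y T ω)]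

/-- A deterministic sequence that dominates `O_P(1)` remainders forces divergence in probability. -/
theorem tendsto_measure_le_of_lower_bound {S Y Z : ℕ → Ω → ℝ} {L a : ℕ → ℝ} {A : ℕ → Set Ω}
    (hL : Tendsto L atTop atTop) (ha : a =o[atTop] L) (hY : BddInProb P Y) (hZ : BddInProb P Z)
    (hA : Tendsto (fun T => P (A T)) atTop (𝓝 0))
    (h : ∀ᶠ T in atTop, ∀ ω ∉ A T, L T - |a T| * |Z T ω| - |Y T ω| ≤ S T ω) (M : ℝ) :
    Tendsto (fun T => P {ω | S T ω ≤ M}) atTop (𝓝 0) := by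
  rw [ENNReal.tendsto_nhds_zero]
  intro ε hε
  have hε3 : 0 < ε / 3 := ENNReal.div_pos hε.ne' (by norm_num)
  obtain ⟨KY, hKY0, hKY⟩ := hY _ hε3
  obtain ⟨KZ, hKZ0, hKZ⟩ := hZ _ hε3
  -- With this constant `|a| |Z| ≤ L / 2` whenever `|Z| ≤ KZ`; then `L > 2 (M + KY)` leaves `S > M`.
  have hab := ha.bound (show (0 : ℝ) < 1 / (2 * (KZ + 1)) by positivity)
  filter_upwards [hKY, hKZ, ENNReal.tendsto_nhds_zero.1 hA _ hε3, h, hab,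
    hL.eventually_gt_atTop (2 * (M + KY)), hL.eventually_gt_atTop 0] with T h1 h2 h3 h4 h5 h6 h7
  calc P {ω | S T ω ≤ M} ≤ P (({ω | KY < |Y T ω|} ∪ {ω | KZ < |Z T ω|}) ∪ A T) := by
        refine measure_mono fun ω hω => ?_
        by_contra! hcon
        simp only [Set.mem_union, Set.mem_ofPred_eq, not_or, not_lt] at hcon hω
        have := h4 ω hcon.2
        rw [Real.norm_eq_abs, Real.norm_eq_abs, abs_of_pos h7] at h5
        have h8 : |a T| * |Z T ω| ≤ L T / 2 := by
          calc |a T| * |Z T ω| ≤ (1 / (2 * (KZ + 1)) * L T) * (KZ + 1) := by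
                refine mul_le_mul h5 (by linarith [hcon.1.2]) (abs_nonneg _) (by positivity)
            _ = L T / 2 := by field_simp
        linarith [hcon.1.1]
    _ ≤ ε / 3 + ε / 3 + ε / 3 := (measure_union_le _ _).trans
      (add_le_add ((measure_union_le _ _).trans (add_le_add h1 h2)) h3)
    _ = ε := ENNReal.add_thirds ε

end BoundedInProbability

/-! ### Second moments of weakly dependent sums -/

section SecondMoments

variable {Ω : Type*} [MeasurableSpace Ω] {P : Measure Ω}

/-- The map `s ↦ t - s` embeds `S` into `ℤ`, so the full two-sided series is a bound uniform in `t`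
and `S`. -/
theorem exists_sum_rpow_abs_sub_le {ζ : ℝ} (hζ : 1 < ζ) :
    ∃ C : ℝ, 0 ≤ C ∧ ∀ (S : Finset ℕ) (t : ℕ),
      ∑ s ∈ S, (|(t : ℝ) - (s : ℝ)| + 1) ^ (-ζ) ≤ C := by
  set g : ℤ → ℝ := fun z => (|(z : ℝ)| + 1) ^ (-ζ) with hg
  have hg0 : ∀ z, 0 ≤ g z := fun z => Real.rpow_nonneg (by positivity) _
  have hnat : Summable fun n : ℕ => ((n : ℝ) + 1) ^ (-ζ) := by
    have := (summable_nat_add_iff 1).2 (Real.summable_nat_rpow.2 (by linarith : -ζ < -1))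
    simpa using this
  have hsum : Summable g := by
    refine Summable.of_nat_of_neg ?_ ?_ <;> simpa [hg] using hnat
  refine ⟨∑' z, g z, tsum_nonneg hg0, fun S t => ?_⟩
  have hinj : Set.InjOn (fun s : ℕ => (t : ℤ) - s) S := fun a _ b _ hab => by
    simp only at hab; omega
  calc ∑ s ∈ S, (|(t : ℝ) - (s : ℝ)| + 1) ^ (-ζ) = ∑ z ∈ S.image fun s : ℕ => (t : ℤ) - s, g z := by
        rw [Finset.sum_image hinj]
        simp [hg]
    _ ≤ ∑' z, g z := hsum.sum_le_tsum _ fun z _ => hg0 z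

/-- Each row of the matrix of product moments has a uniformly bounded sum, so the double sum grows
linearly in the number of terms. -/
theorem exists_integral_sum_sq_le {f : ℕ → Ω → ℝ} (hf : ∀ t, MemLp (f t) 2 P) {c ζ : ℝ}
    (hc : 0 < c) (hζ : 2 < ζ)
    (h : ∀ t s : ℕ, |∫ ω, f t ω * f s ω ∂P| ≤ c * (|(t : ℝ) - (s : ℝ)| + 1) ^ (-ζ)) :
    ∃ C : ℝ, 0 ≤ C ∧ ∀ S : Finset ℕ, ∫ ω, (∑ s ∈ S, f s ω) ^ 2 ∂P ≤ C * S.card := by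
  obtain ⟨C, hC0, hC⟩ := exists_sum_rpow_abs_sub_le (by linarith : 1 < ζ)
  refine ⟨c * C, by positivity, fun S => ?_⟩
  have hint : ∀ t s, Integrable (fun ω => f t ω * f s ω) P := fun t s =>
    (hf t).integrable_mul (hf s)
  simp_rw [sq, Finset.sum_mul_sum]
  rw [integral_finsetSum _ fun t _ => integrable_finsetSum _ fun s _ => hint t s]
  calc ∑ t ∈ S, ∫ ω, ∑ s ∈ S, f t ω * f s ω ∂P ≤ ∑ t ∈ S, c * C := by
        refine Finset.sum_le_sum fun t _ => ?_
        rw [integral_finsetSum _ fun s _ => hint t s]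
        calc _ ≤ ∑ s ∈ S, c * (|(t : ℝ) - (s : ℝ)| + 1) ^ (-ζ) :=
              Finset.sum_le_sum fun s _ => (le_abs_self _).trans (h t s)
          _ ≤ c * C := by
            rw [← Finset.mul_sum]
            exact mul_le_mul_of_nonneg_left (hC S t) hc.le
    _ = c * C * S.card := by simp [mul_comm]

/-- Averages over at least `τ` terms, normalised by `√τ`, are bounded in probability. -/
theorem bddInProb_sqrt_mul_average [IsProbabilityMeasure P] {f : ℕ → Ω → ℝ}
    (hf : ∀ t, MemLp (f t) 2 P) {c ζ : ℝ} (hc : 0 < c) (hζ : 2 < ζ)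
    (h : ∀ t s : ℕ, |∫ ω, f t ω * f s ω ∂P| ≤ c * (|(t : ℝ) - (s : ℝ)| + 1) ^ (-ζ))
    {trim : ℕ → ℝ} {S : ℕ → Finset ℕ} {n : ℕ → ℝ}
    (hS : ∀ᶠ T in atTop, 0 < trim T ∧ trim T ≤ n T ∧ ((S T).card : ℝ) = n T) :
    BddInProb P (fun T ω => √(trim T) * (1 / n T * ∑ s ∈ S T, f s ω)) := by
  obtain ⟨C, hC0, hC⟩ := exists_integral_sum_sq_le hf hc hζ h
  refine BddInProb.of_integral_sq_le C ?_
  filter_upwards [hS] with T hT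
  obtain ⟨h0, h1, h2⟩ := hT
  have hn : 0 < n T := h0.trans_le h1
  refine ⟨((memLp_finsetSum _ fun s _ => hf s).const_mul _).const_mul _, ?_⟩
  have : ∀ ω, (√(trim T) * (1 / n T * ∑ s ∈ S T, f s ω)) ^ 2 =
      trim T / n T ^ 2 * (∑ s ∈ S T, f s ω) ^ 2 := fun ω => by
    rw [mul_pow, Real.sq_sqrt h0.le]; field_simp
  simp_rw [this]
  rw [integral_const_mul]
  -- Since `trim T ≤ n T`, the linear growth of the second moment cancels the normalisation.
  calc trim T / n T ^ 2 * ∫ ω, (∑ s ∈ S T, f s ω) ^ 2 ∂P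
      ≤ n T / n T ^ 2 * (C * (S T).card) := by
        refine mul_le_mul (by gcongr) (hC _) (integral_nonneg fun ω => sq_nonneg _)
          (by positivity)
    _ = C := by rw [h2]; field_simp

/-- Averages of a sequence that is bounded in `L¹` are bounded in probability. -/
theorem bddInProb_average [IsProbabilityMeasure P] {f : ℕ → Ω → ℝ} {C : ℝ}
    (hf : ∀ t, Integrable (f t) P) (h : ∀ t, ∫ ω, |f t ω| ∂P ≤ C) :
    BddInProb P (fun T ω => (T : ℝ)⁻¹ * ∑ s ∈ Finset.Icc 1 T, |f s ω|) := by
  refine BddInProb.of_integral_le C ?_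
  filter_upwards [eventually_gt_atTop 0] with T hT
  have hT' : (0 : ℝ) < T := by exact_mod_cast hT
  refine ⟨(integrable_finsetSum _ fun s _ => (hf s).abs).const_mul _, ?_⟩
  have : ∀ ω, abs ((T : ℝ)⁻¹ * ∑ s ∈ Finset.Icc 1 T, |f s ω|) =
      (T : ℝ)⁻¹ * ∑ s ∈ Finset.Icc 1 T, |f s ω| := fun ω =>
    abs_of_nonneg (mul_nonneg (by positivity) (Finset.sum_nonneg fun s _ => abs_nonneg _))
  simp_rw [this]
  rw [integral_const_mul, integral_finsetSum _ fun s _ => (hf s).abs]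
  calc _ ≤ (T : ℝ)⁻¹ * ∑ s ∈ Finset.Icc 1 T, C := by
        gcongr with s; exact h s
    _ = C := by simp; field_simp

end SecondMoments

/-! ### Transfer between the sequence `x` and its law on path space -/

section Stationary

variable {Ω : Type*} [MeasurableSpace Ω] {P : Measure Ω} {d : ℕ} {x : ℕ → Ω → Fin d → ℝ}

theorem shift_iterate (k : ℕ) (y : ℕ → Fin d → ℝ) : shift^[k] y = fun t => y (t + k) := by
  induction k with
  | zero => rfl
  | succ k ih =>
    rw [Function.iterate_succ_apply', ih]
    funext t
    simp [shift, add_assoc, add_comm 1 k]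

/-- The path delayed by `k` is the `k`-th shift of the path, whose law is invariant. Moments at time
`k` are reduced to time `0` through this. -/
theorem measurePreserving_path (hx : ∀ t, Measurable (x t)) (hs : StationaryErgodic P x) (k : ℕ) :
    MeasurePreserving (fun ω t => x (t + k) ω) P (P.map fun ω t => x t ω) := by
  have h0 : MeasurePreserving (fun ω t => x t ω) P (P.map fun ω t => x t ω) :=
    ⟨measurable_pi_lambda _ hx, rfl⟩
  have := (hs.toMeasurePreserving.iterate k).comp h0
  convert this using 1
  funext ω
  exact (shift_iterate k fun t => x t ω).symm

theorem integral_path_add (hx : ∀ t, Measurable (x t)) (hs : StationaryErgodic P x) (k : ℕ)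
    {f : (ℕ → Fin d → ℝ) → ℝ} (hf : Measurable f) :
    ∫ ω, f (fun t => x (t + k) ω) ∂P = ∫ ω, f (fun t => x t ω) ∂P := by
  have h : ∀ k, ∫ ω, f (fun t => x (t + k) ω) ∂P = ∫ y, f y ∂(P.map fun ω t => x t ω) := fun k => by
    have hk := measurePreserving_path hx hs k
    rw [← hk.map_eq, integral_map hk.aemeasurable hf.aestronglyMeasurable]
  rw [h k, ← h 0]
  rfl

theorem memLp_path_add (hx : ∀ t, Measurable (x t)) (hs : StationaryErgodic P x) (k : ℕ)
    {f : (ℕ → Fin d → ℝ) → ℝ} (hf : Measurable f) {p : ℝ≥0∞}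
    (h : MemLp (fun ω => f fun t => x t ω) p P) : MemLp (fun ω => f fun t => x (t + k) ω) p P := by
  have h0 := measurePreserving_path hx hs 0
  have : MemLp f p (P.map fun ω t => x t ω) :=
    (memLp_map_measure_iff hf.aestronglyMeasurable h0.aemeasurable).2 h
  exact this.comp_measurePreserving (measurePreserving_path hx hs k)

/-- Mean ergodic theorem for a stationary ergodic sequence, as convergence in probability. -/
theorem tendsto_measure_average_sub_gt [IsProbabilityMeasure P] (hx : ∀ t, Measurable (x t))
    (hs : StationaryErgodic P x) {f : (ℕ → Fin d → ℝ) → ℝ} (hf : Measurable f)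
    (hfi : Integrable (fun ω => f fun t => x t ω) P) {δ : ℝ} (hδ : 0 < δ) :
    Tendsto (fun n : ℕ => P {ω | δ ≤ |(n : ℝ)⁻¹ * ∑ k ∈ Finset.range n, f (fun t => x (t + k) ω) -
      ∫ ω, f (fun t => x t ω) ∂P|}) atTop (𝓝 0) := by
  have hp := measurePreserving_path hx hs 0
  have : IsProbabilityMeasure (P.map fun ω t => x t ω) := hp.map_eq ▸
    Measure.isProbabilityMeasure_map hp.aemeasurable
  have hfμ : Integrable f (P.map fun ω t => x t ω) :=
    (integrable_map_measure hf.aestronglyMeasurable hp.aemeasurable).2 hfi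
  have hI : ∫ y, f y ∂(P.map fun ω t => x t ω) = ∫ ω, f (fun t => x t ω) ∂P :=
    integral_map hp.aemeasurable hf.aestronglyMeasurable
  have h1 := tendsto_eLpNorm_one_birkhoffAverage hs hfμ
  have hm : ∀ n : ℕ, Measurable (fun y => (n : ℝ)⁻¹ * ∑ k ∈ Finset.range n, f (shift^[k] y) -
      ∫ ω, f (fun t => x t ω) ∂P) := fun n =>
    ((Finset.measurable_sum _ fun k _ => hf.comp
      (hs.toMeasurePreserving.measurable.iterate k)).const_mul _).sub_const _
  -- The ergodic average lives on path space; the path map preserves measure, so the `L¹` norm is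
  -- unchanged by the pullback to `Ω`.
  have h2 : Tendsto (fun n : ℕ => eLpNorm ((fun ω => (n : ℝ)⁻¹ * ∑ k ∈ Finset.range n,
      f (fun t => x (t + k) ω) - ∫ ω, f (fun t => x t ω) ∂P) - fun _ => 0) 1 P) atTop (𝓝 0) := by
    refine h1.congr fun n => ?_
    rw [hI, ← eLpNorm_comp_measurePreserving (hm n).aestronglyMeasurable hp]
    congr 1
    funext ω
    simp [shift_iterate]
  have hp' := hp.measurable
  have h3 := tendstoInMeasure_of_tendsto_eLpNorm (by simp)
    (fun n => (((hm n).comp hp').aestronglyMeasurable (μ := P)).congr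
      (ae_of_all _ fun ω => by simp [shift_iterate])) aestronglyMeasurable_const h2
  simpa [tendstoInMeasure_iff_norm] using
    (tendstoInMeasure_iff_norm.1 h3 δ hδ)

end Stationary

/-! ### Algebra of least squares and of the residual contrast -/

section Deterministic

variable {d : ℕ}

/-- The entries of the inverse are bounded in a neighbourhood of an invertible matrix. -/
theorem exists_abs_inv_apply_le_of_near (C : Matrix (Fin d) (Fin d) ℝ) (hC : IsUnit C) :
    ∃ δ : ℝ, 0 < δ ∧ ∃ K : ℝ, 0 ≤ K ∧ ∀ A : Matrix (Fin d) (Fin d) ℝ,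
      (∀ i j, |A i j - C i j| < δ) → IsUnit A.det ∧ ∀ i j, |A⁻¹ i j| ≤ K := by
  have hdet : C.det ≠ 0 := ((Matrix.isUnit_iff_isUnit_det C).1 hC).ne_zero
  -- Cramer's formula makes the entries of the inverse continuous where the determinant does not
  -- vanish.
  have hinv : ∀ A : Matrix (Fin d) (Fin d) ℝ, ∀ i j, A⁻¹ i j = A.det⁻¹ * A.adjugate i j := by
    intro A i j
    rw [Matrix.inv_def, Ring.inverse_eq_inv']
    rfl
  have h1 : ∀ᶠ A in 𝓝 C, A.det ≠ 0 := by
    have : Continuous fun A : Matrix (Fin d) (Fin d) ℝ => A.det := continuous_id.matrix_det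
    exact this.continuousAt.eventually_ne hdet
  have h2 : ∀ᶠ A in 𝓝 C, ∀ i j, |A⁻¹ i j| < ∑ i, ∑ j, |C⁻¹ i j| + 1 := by
    rw [eventually_all]; intro i
    rw [eventually_all]; intro j
    have hc : ContinuousAt (fun A : Matrix (Fin d) (Fin d) ℝ => |A⁻¹ i j|) C := by
      simp_rw [hinv]
      refine (ContinuousAt.mul (ContinuousAt.inv₀ ?_ hdet) ?_).abs
      · exact (continuous_id.matrix_det).continuousAt
      · exact (continuous_id.matrix_adjugate.matrix_elem i j).continuousAt
    refine hc.eventually_lt_const ?_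
    have a1 : |C⁻¹ i j| ≤ ∑ j, |C⁻¹ i j| :=
      Finset.single_le_sum (f := fun j => |C⁻¹ i j|) (fun j _ => abs_nonneg _) (Finset.mem_univ j)
    have a2 : ∑ j, |C⁻¹ i j| ≤ ∑ i, ∑ j, |C⁻¹ i j| :=
      Finset.single_le_sum (f := fun i => ∑ j, |C⁻¹ i j|)
        (fun i _ => Finset.sum_nonneg fun j _ => abs_nonneg _) (Finset.mem_univ i)
    linarith
  -- The same statement on bare functions, where the sup metric turns a ball into the entrywise
  -- condition.
  have h3 : ∀ᶠ A : Fin d → Fin d → ℝ in 𝓝 (fun i j => C i j),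
      (Matrix.of A).det ≠ 0 ∧ ∀ i j, |(Matrix.of A)⁻¹ i j| < ∑ i, ∑ j, |C⁻¹ i j| + 1 := h1.and h2
  obtain ⟨δ, hδ, hball⟩ := Metric.eventually_nhds_iff.1 h3
  refine ⟨δ, hδ, ∑ i, ∑ j, |C⁻¹ i j| + 1, by positivity, fun A hA => ?_⟩
  have hd : dist (fun i j => A i j) (fun i j => C i j) < δ :=
    (dist_pi_lt_iff hδ).2 fun i => (dist_pi_lt_iff hδ).2 fun j => hA i j
  exact ⟨(hball hd).1.isUnit, fun i j => ((hball hd).2 i j).le⟩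

theorem abs_dotProduct_le (u w : Fin d → ℝ) : |u ⬝ᵥ w| ≤ ∑ i, |u i| * |w i| := by
  simp_rw [dotProduct, ← abs_mul]
  exact Finset.abs_sum_le_sum_abs _ _

/-- Any `m` is allowed; with the mean vector the last term is the small centred part. -/
theorem average_dotProduct {S : Finset ℕ} {n : ℝ} (hn : n ≠ 0) (hS : (S.card : ℝ) = n)
    (v : ℕ → Fin d → ℝ) (m u : Fin d → ℝ) :
    1 / n * ∑ s ∈ S, v s ⬝ᵥ u =
      m ⬝ᵥ u + (fun i => 1 / n * ∑ s ∈ S, (v s i - m i)) ⬝ᵥ u := by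
  have h : (fun i => 1 / n * ∑ s ∈ S, (v s i - m i)) = (1 / n) • (∑ s ∈ S, v s) - m := by
    funext i
    simp only [Pi.sub_apply, Pi.smul_apply, Finset.sum_apply, smul_eq_mul,
      Finset.sum_sub_distrib, Finset.sum_const, nsmul_eq_mul, hS]
    field_simp
  rw [h, sub_dotProduct, smul_dotProduct, sum_dotProduct, smul_eq_mul]
  ring

/-- The estimation error of least squares, relative to the coefficient vector `b₂`. -/
theorem abs_leastSquares_sub_le {Ω : Type*} (x : ℕ → Ω → Fin d → ℝ) (e : ℕ → Ω → ℝ)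
    (b₁ b₂ : Fin d → ℝ) {k T : ℕ} (hT : 0 < T) (ω : Ω) {K : ℝ} (hK : 0 ≤ K)
    (hA : IsUnit (Matrix.of fun i j : Fin d =>
      (T : ℝ)⁻¹ * ∑ s ∈ Finset.Icc 1 T, x s ω i * x s ω j).det)
    (hAK : ∀ i j, |(Matrix.of fun i j : Fin d =>
      (T : ℝ)⁻¹ * ∑ s ∈ Finset.Icc 1 T, x s ω i * x s ω j)⁻¹ i j| ≤ K) (i : Fin d) :
    |leastSquares x (response x e b₁ b₂ k) T ω i - b₂ i| ≤
      K * (‖b₁ - b₂‖ * (∑ j, ∑ l, (T : ℝ)⁻¹ * ∑ s ∈ Finset.Icc 1 T, |x s ω j * x s ω l|) +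
        ∑ j, (T : ℝ)⁻¹ * ∑ s ∈ Finset.Icc 1 T, |x s ω j * e s ω|) := by
  set A : Matrix (Fin d) (Fin d) ℝ := Matrix.of fun i j : Fin d =>
      (T : ℝ)⁻¹ * ∑ s ∈ Finset.Icc 1 T, x s ω i * x s ω j with hAdef
  have hT0 : (T : ℝ) ≠ 0 := by exact_mod_cast hT.ne'
  have hTpos : (0 : ℝ) < T := by exact_mod_cast hT
  set Z := designMatrix x T ω with hZ
  set X : ℕ → Ω → ℝ := response x e b₁ b₂ k with hX
  have hfin : ∀ f : ℕ → ℝ, ∑ s : Fin T, f ((s : ℕ) + 1) = ∑ s ∈ Finset.Icc 1 T, f s := by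
    intro f
    rw [Fin.sum_univ_eq_sum_range fun s => f (s + 1), Finset.range_eq_Ico,
      Finset.sum_Ico_add' f 0 T 1]
    rfl
  have hG : Zᵀ * Z = (T : ℝ) • A := by
    ext a b
    simp only [Matrix.mul_apply, Matrix.transpose_apply, hZ, designMatrix, Matrix.of_apply,
      Matrix.smul_apply, hAdef, smul_eq_mul]
    rw [hfin fun s => x s ω a * x s ω b, mul_inv_cancel_left₀ hT0]
  have hGu : IsUnit (Zᵀ * Z).det := by
    rw [hG, Matrix.det_smul]
    exact ((hT0.isUnit).pow _).mul hA
  set y : Fin T → ℝ := fun s => X ((s : ℕ) + 1) ω with hy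
  have hnormal : (Zᵀ * Z) *ᵥ leastSquares x X T ω = Zᵀ *ᵥ y := by
    rw [leastSquares, Matrix.mulVec_mulVec, ← Matrix.mul_assoc, Matrix.mul_nonsing_inv _ hGu,
      Matrix.one_mul]
  set h : Fin d → ℝ := fun j => (T : ℝ)⁻¹ * ∑ s ∈ Finset.Icc 1 T,
    x s ω j * (X s ω - x s ω ⬝ᵥ b₂) with hh
  -- Normal equations for the shifted response `X_s - x_s·b₂`, divided by `T`.
  have hθ : A *ᵥ (leastSquares x X T ω - b₂) = h := by
    have h1 : (T : ℝ) • (A *ᵥ (leastSquares x X T ω - b₂)) = Zᵀ *ᵥ (y - Z *ᵥ b₂) := by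
      rw [← Matrix.smul_mulVec, ← hG, Matrix.mulVec_sub, hnormal, Matrix.mulVec_sub,
        Matrix.mulVec_mulVec]
    have h2 : Zᵀ *ᵥ (y - Z *ᵥ b₂) = (T : ℝ) • h := by
      funext j
      simp only [Matrix.mulVec, dotProduct, Matrix.transpose_apply, hZ, designMatrix,
        Matrix.of_apply, Pi.sub_apply, Pi.smul_apply, smul_eq_mul, hh, hy]
      rw [mul_inv_cancel_left₀ hT0]
      exact hfin fun s => x s ω j * (X s ω - ∑ i, x s ω i * b₂ i)
    rw [h2] at h1
    exact smul_right_injective _ hT0 h1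
  have hθ' : leastSquares x X T ω - b₂ = A⁻¹ *ᵥ h := by
    rw [← hθ, Matrix.mulVec_mulVec, Matrix.nonsing_inv_mul _ hA, Matrix.one_mulVec]
  -- After the change the shifted response is `e_s`; before it, the extra term `x_s·(b₁ - b₂)`
  -- appears.
  have hXb : ∀ s, |X s ω - x s ω ⬝ᵥ b₂| ≤ ‖b₁ - b₂‖ * ∑ l, |x s ω l| + |e s ω| := by
    intro s
    have hsum0 : 0 ≤ ∑ l, |x s ω l| := Finset.sum_nonneg fun l _ => abs_nonneg _
    simp only [hX, response, coefAt]
    split_ifs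
    · have e1 : x s ω ⬝ᵥ b₁ + e s ω - x s ω ⬝ᵥ b₂ = x s ω ⬝ᵥ (b₁ - b₂) + e s ω := by
        rw [dotProduct_sub]; ring
      rw [e1]
      refine (abs_add_le _ _).trans (add_le_add_left ((abs_dotProduct_le _ _).trans ?_) _)
      rw [Finset.mul_sum]
      refine Finset.sum_le_sum fun l _ => ?_
      rw [mul_comm]
      exact mul_le_mul_of_nonneg_right (norm_le_pi_norm (b₁ - b₂) l) (abs_nonneg _)
    · rw [add_sub_cancel_left]
      have := mul_nonneg (norm_nonneg (b₁ - b₂)) hsum0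
      linarith
  have hhb : ∀ j, |h j| ≤ ‖b₁ - b₂‖ * (∑ l, (T : ℝ)⁻¹ * ∑ s ∈ Finset.Icc 1 T,
      |x s ω j * x s ω l|) + (T : ℝ)⁻¹ * ∑ s ∈ Finset.Icc 1 T, |x s ω j * e s ω| := by
    intro j
    simp only [hh]
    rw [abs_mul, abs_of_nonneg (by positivity : (0 : ℝ) ≤ (T : ℝ)⁻¹), ← Finset.mul_sum,
      Finset.sum_comm, mul_left_comm, ← mul_add]
    refine mul_le_mul_of_nonneg_left ?_ (by positivity)
    rw [Finset.mul_sum, ← Finset.sum_add_distrib]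
    refine (Finset.abs_sum_le_sum_abs _ _).trans (Finset.sum_le_sum fun s _ => ?_)
    simp_rw [abs_mul, ← Finset.mul_sum]
    calc _ ≤ |x s ω j| * (‖b₁ - b₂‖ * ∑ l, |x s ω l| + |e s ω|) :=
          mul_le_mul_of_nonneg_left (hXb s) (abs_nonneg _)
      _ = _ := by ring
  rw [← Pi.sub_apply, hθ']
  calc |(A⁻¹ *ᵥ h) i| ≤ ∑ j, |A⁻¹ i j| * |h j| := abs_dotProduct_le _ _
    _ ≤ ∑ j, K * |h j| := Finset.sum_le_sum fun j _ =>
        mul_le_mul_of_nonneg_right (hAK i j) (abs_nonneg _)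
    _ = K * ∑ j, |h j| := by rw [Finset.mul_sum]
    _ ≤ _ := by
      refine mul_le_mul_of_nonneg_left ?_ hK
      rw [Finset.mul_sum, ← Finset.sum_add_distrib]
      exact Finset.sum_le_sum fun j _ => hhb j

theorem le_renyiStat (r : ℕ → ℝ) {T k : ℕ} {τ : ℝ} (h1 : τ ≤ k) (h2 : (k : ℝ) ≤ T - τ)
    (hk : k ≤ T) :
    |1 / (k : ℝ) * ∑ s ∈ Finset.Icc 1 k, r s
      - 1 / ((T : ℝ) - k) * ∑ s ∈ Finset.Icc (k + 1) T, r s| ≤ renyiStat r T τ := by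
  have hmem : k ∈ (Finset.range (T + 1)).filter fun t : ℕ => τ ≤ (t : ℝ) ∧ (t : ℝ) ≤ (T : ℝ) - τ :=
    by simp [h1, h2, Nat.lt_succ_of_le hk]
  have := Finset.le_sup (f := fun t : ℕ => ‖(1 / (t : ℝ)) * ∑ s ∈ Finset.Icc 1 t, r s
      - (1 / ((T : ℝ) - (t : ℝ))) * ∑ s ∈ Finset.Icc (t + 1) T, r s‖₊) hmem
  exact NNReal.coe_le_coe.2 this

/-- The residual contrast at the time of change, in terms of centred averages. -/
theorem residual_contrast_eq {Ω : Type*} (x : ℕ → Ω → Fin d → ℝ) (e : ℕ → Ω → ℝ)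
    (b₁ b₂ m : Fin d → ℝ) {k T : ℕ} (hk : 0 < k) (hkT : k < T) (ω : Ω) :
    1 / (k : ℝ) * ∑ s ∈ Finset.Icc 1 k, residual x (response x e b₁ b₂ k) T s ω
      - 1 / ((T : ℝ) - k) * ∑ s ∈ Finset.Icc (k + 1) T, residual x (response x e b₁ b₂ k) T s ω =
    m ⬝ᵥ (b₁ - b₂) + (fun i => 1 / (k : ℝ) * ∑ s ∈ Finset.Icc 1 k, (x s ω i - m i)) ⬝ᵥ (b₁ - b₂)
      - (fun i => 1 / (k : ℝ) * ∑ s ∈ Finset.Icc 1 k, (x s ω i - m i)) ⬝ᵥ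
        (leastSquares x (response x e b₁ b₂ k) T ω - b₂)
      + (fun i => 1 / ((T : ℝ) - k) * ∑ s ∈ Finset.Icc (k + 1) T, (x s ω i - m i)) ⬝ᵥ
        (leastSquares x (response x e b₁ b₂ k) T ω - b₂)
      + 1 / (k : ℝ) * ∑ s ∈ Finset.Icc 1 k, e s ω
      - 1 / ((T : ℝ) - k) * ∑ s ∈ Finset.Icc (k + 1) T, e s ω := by
  set B := leastSquares x (response x e b₁ b₂ k) T ω with hB
  have hk0 : (k : ℝ) ≠ 0 := by exact_mod_cast hk.ne'
  have hkT0 : (T : ℝ) - k ≠ 0 := sub_ne_zero.2 (by exact_mod_cast hkT.ne')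
  have c1 : ((Finset.Icc 1 k).card : ℝ) = k := by simp
  have c2 : ((Finset.Icc (k + 1) T).card : ℝ) = T - k := by
    rw [Nat.card_Icc, Nat.add_sub_add_right, Nat.cast_sub hkT.le]
  have s1 : ∑ s ∈ Finset.Icc 1 k, residual x (response x e b₁ b₂ k) T s ω =
      ∑ s ∈ Finset.Icc 1 k, x s ω ⬝ᵥ (b₁ - b₂) - ∑ s ∈ Finset.Icc 1 k, x s ω ⬝ᵥ (B - b₂)
        + ∑ s ∈ Finset.Icc 1 k, e s ω := by
    rw [← Finset.sum_sub_distrib, ← Finset.sum_add_distrib]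
    refine Finset.sum_congr rfl fun s hs => ?_
    simp only [residual, response, coefAt, if_pos (Finset.mem_Icc.1 hs).2, dotProduct_sub, ← hB]
    ring
  have s2 : ∑ s ∈ Finset.Icc (k + 1) T, residual x (response x e b₁ b₂ k) T s ω =
      -∑ s ∈ Finset.Icc (k + 1) T, x s ω ⬝ᵥ (B - b₂) + ∑ s ∈ Finset.Icc (k + 1) T, e s ω := by
    rw [← Finset.sum_neg_distrib, ← Finset.sum_add_distrib]
    refine Finset.sum_congr rfl fun s hs => ?_
    have : ¬ s ≤ k := by have := (Finset.mem_Icc.1 hs).1; omega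
    simp only [residual, response, coefAt, if_neg this, dotProduct_sub, ← hB]
    ring
  -- Both halves produce `-m·(B - b₂)`, which cancels in the difference.
  rw [s1, s2, mul_add, mul_sub, mul_add, mul_neg, average_dotProduct hk0 c1 (fun s => x s ω) m,
    average_dotProduct hk0 c1 (fun s => x s ω) m, average_dotProduct hkT0 c2 (fun s => x s ω) m]
  ring

end Deterministic

/-! ### Probabilistic bounds for the regression model -/

section Regression

variable {Ω : Type*} [MeasurableSpace Ω] {P : Measure Ω} {d : ℕ} {x : ℕ → Ω → Fin d → ℝ}
  {e : ℕ → Ω → ℝ}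

theorem measurable_eval_apply (t : ℕ) (i : Fin d) :
    Measurable fun y : ℕ → Fin d → ℝ => y t i :=
  (measurable_pi_apply i).comp (measurable_pi_apply t)

theorem DependenceAssumption.memLp_apply (h : DependenceAssumption P x e) (t : ℕ) (i : Fin d) :
    MemLp (fun ω => x t ω i) 2 P := by
  have := memLp_path_add h.measurable_x h.stationaryErgodic t (measurable_eval_apply 0 i)
    (h.memLp_x i)
  simpa using this

theorem DependenceAssumption.integral_apply (h : DependenceAssumption P x e) (t : ℕ) (i : Fin d) :
    ∫ ω, x t ω i ∂P = meanVec P x i := by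
  have := integral_path_add h.measurable_x h.stationaryErgodic t (measurable_eval_apply 0 i)
  simpa [meanVec] using this

/-- Stationarity moves the earlier time to `0`, where the covariance hypothesis applies with lag `|t
- s|`. -/
theorem DependenceAssumption.exists_moment_centred_le [IsProbabilityMeasure P]
    (h : DependenceAssumption P x e) :
    ∃ c ζ : ℝ, 0 < c ∧ 2 < ζ ∧ ∀ (i : Fin d) (t s : ℕ),
      |∫ ω, (x t ω i - meanVec P x i) * (x s ω i - meanVec P x i) ∂P| ≤
        c * (|(t : ℝ) - (s : ℝ)| + 1) ^ (-ζ) := by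
  obtain ⟨c, ζ, hc, hζ, hcov⟩ := h.cov_x
  refine ⟨c, ζ, hc, hζ, fun i => ?_⟩
  have key : ∀ t u : ℕ, |∫ ω, (x t ω i - meanVec P x i) * (x (t + u) ω i - meanVec P x i) ∂P| ≤
      c * ((u : ℝ) + 1) ^ (-ζ) := by
    intro t u
    have hst := integral_path_add h.measurable_x h.stationaryErgodic t
      (f := fun y => (y 0 i - meanVec P x i) * (y u i - meanVec P x i))
      (((measurable_eval_apply 0 i).sub_const _).mul ((measurable_eval_apply u i).sub_const _))
    have hcu := hcov i u
    rw [covariance, h.integral_apply, h.integral_apply, ← hst] at hcu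
    simpa [add_comm] using hcu
  intro t s
  rcases le_total t s with hts | hts
  · obtain ⟨u, rfl⟩ := Nat.exists_eq_add_of_le hts
    have : |(t : ℝ) - ((t + u : ℕ) : ℝ)| = u := by
      push_cast; rw [sub_add_cancel_left, abs_neg, Nat.abs_cast]
    rw [this]
    exact key t u
  · obtain ⟨u, rfl⟩ := Nat.exists_eq_add_of_le hts
    have : |((s + u : ℕ) : ℝ) - (s : ℝ)| = u := by
      push_cast; rw [add_sub_cancel_left, Nat.abs_cast]
    rw [this]
    simp_rw [mul_comm (x (s + u) _ i - _)]
    exact key s u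

theorem DependenceAssumption.bddInProb_average_mul [IsProbabilityMeasure P]
    (h : DependenceAssumption P x e) (i j : Fin d) :
    BddInProb P (fun T ω => (T : ℝ)⁻¹ * ∑ s ∈ Finset.Icc 1 T, |x s ω i * x s ω j|) := by
  refine bddInProb_average (C := ∫ ω, |x 0 ω i * x 0 ω j| ∂P)
    (fun t => (h.memLp_apply t i).integrable_mul (h.memLp_apply t j)) fun t => ?_
  have := integral_path_add h.measurable_x h.stationaryErgodic t
    (f := fun y => |y 0 i * y 0 j|)
    ((measurable_eval_apply 0 i).mul (measurable_eval_apply 0 j)).abs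
  simp only [zero_add] at this
  exact this.le

theorem DependenceAssumption.bddInProb_average_mul_error [IsProbabilityMeasure P]
    (h : DependenceAssumption P x e) (i : Fin d) :
    BddInProb P (fun T ω => (T : ℝ)⁻¹ * ∑ s ∈ Finset.Icc 1 T, |x s ω i * e s ω|) := by
  obtain ⟨c, ζ, hc, hζ, he⟩ := h.moment_e
  have hint : ∀ t, Integrable (fun ω => x t ω i * e t ω) P := fun t =>
    (h.memLp_apply t i).integrable_mul (h.memLp_e t)
  refine bddInProb_average (C := ∫ ω, x 0 ω i ^ 2 ∂P + c) hint fun t => ?_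
  have hx := integral_path_add h.measurable_x h.stationaryErgodic t
    (f := fun y => y 0 i ^ 2) ((measurable_eval_apply 0 i).pow_const 2)
  simp only [zero_add] at hx
  -- On the diagonal the weight is `1 ^ (-ζ) = 1`, so `c` bounds all second moments of the errors.
  have het : ∫ ω, e t ω ^ 2 ∂P ≤ c := by
    have := (le_abs_self _).trans (he t t)
    simpa [sq] using this
  calc ∫ ω, |x t ω i * e t ω| ∂P ≤ ∫ ω, (x t ω i ^ 2 + e t ω ^ 2) ∂P := by
        refine integral_mono (hint t).abs
          ((h.memLp_apply t i).integrable_sq.add (h.memLp_e t).integrable_sq) fun ω => ?_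
        simp only [abs_mul]
        nlinarith [sq_nonneg (|x t ω i| - |e t ω|), sq_abs (x t ω i), sq_abs (e t ω),
          sq_nonneg (x t ω i), sq_nonneg (e t ω)]
    _ = ∫ ω, x t ω i ^ 2 ∂P + ∫ ω, e t ω ^ 2 ∂P :=
        integral_add (h.memLp_apply t i).integrable_sq (h.memLp_e t).integrable_sq
    _ ≤ _ := by rw [hx]; linarith

theorem DependenceAssumption.tendsto_measure_average_mul [IsProbabilityMeasure P]
    (h : DependenceAssumption P x e) (i j : Fin d) {δ : ℝ} (hδ : 0 < δ) :
    Tendsto (fun T : ℕ => P {ω | δ ≤ |(T : ℝ)⁻¹ * ∑ s ∈ Finset.Icc 1 T, x s ω i * x s ω j -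
      momentMatrix P x i j|}) atTop (𝓝 0) := by
  have hm : ∀ t, Measurable fun y : ℕ → Fin d → ℝ => y t i * y t j := fun t =>
    (measurable_eval_apply t i).mul (measurable_eval_apply t j)
  -- Coordinate `1` is used because the sample runs over `1, …, T`; stationarity then returns the
  -- mean to time `0`.
  have h1 := tendsto_measure_average_sub_gt h.measurable_x h.stationaryErgodic (hm 1)
    ((h.memLp_apply 1 i).integrable_mul (h.memLp_apply 1 j)) hδ
  have h2 := integral_path_add h.measurable_x h.stationaryErgodic 1 (hm 0)
  simp only [zero_add] at h2
  have h3 : ∀ (T : ℕ) (ω : Ω), ∑ k ∈ Finset.range T, x (1 + k) ω i * x (1 + k) ω j =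
      ∑ s ∈ Finset.Icc 1 T, x s ω i * x s ω j := by
    intro T ω
    rw [Finset.range_eq_Ico, Finset.sum_Ico_add (fun s => x s ω i * x s ω j) 0 T 1]
    rfl
  simp only [h2, h3] at h1
  exact h1

/-- Both halves of the sample, split at the time of change, give averages that are
`O_P(trim^{-1/2})` when the summands have summable product moments. -/
theorem bddInProb_sqrt_mul_average_split [IsProbabilityMeasure P] {f : ℕ → Ω → ℝ}
    (hf : ∀ t, MemLp (f t) 2 P) {c ζ : ℝ} (hc : 0 < c) (hζ : 2 < ζ)
    (h : ∀ t s : ℕ, |∫ ω, f t ω * f s ω ∂P| ≤ c * (|(t : ℝ) - (s : ℝ)| + 1) ^ (-ζ))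
    {trim : ℕ → ℝ} {k : ℕ → ℕ} (htrim : Tendsto trim atTop atTop) (hk : ∀ᶠ T in atTop, k T < T)
    (hloc : ∀ᶠ T : ℕ in atTop, trim T ≤ (k T : ℝ) ∧ (k T : ℝ) ≤ (T : ℝ) - trim T) :
    BddInProb P (fun T ω => √(trim T) * (1 / (k T : ℝ) * ∑ s ∈ Finset.Icc 1 (k T), f s ω)) ∧
    BddInProb P (fun T ω => √(trim T) *
      (1 / ((T : ℝ) - k T) * ∑ s ∈ Finset.Icc (k T + 1) T, f s ω)) := by
  constructor
  · refine bddInProb_sqrt_mul_average hf hc hζ h ?_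
    filter_upwards [htrim.eventually_gt_atTop 0, hloc] with T h1 h2
    exact ⟨h1, h2.1, by simp⟩
  · refine bddInProb_sqrt_mul_average hf hc hζ h (n := fun T => (T : ℝ) - k T) ?_
    filter_upwards [htrim.eventually_gt_atTop 0, hloc, hk] with T h1 h2 h3
    refine ⟨h1, by linarith, ?_⟩
    rw [Nat.card_Icc, Nat.add_sub_add_right, Nat.cast_sub h3.le]

theorem BddInProb.abs {Y : ℕ → Ω → ℝ} (h : BddInProb P Y) : BddInProb P (fun T ω => |Y T ω|) :=
  h.of_abs_le (Eventually.of_forall fun T ω => by simp)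

/-- Union bound over the entries; off this event the inverse of `ZᵀZ / T` is under control. -/
theorem tendsto_measure_exists_average_mul [IsProbabilityMeasure P]
    (h : DependenceAssumption P x e) {δ : ℝ} (hδ : 0 < δ) :
    Tendsto (fun T : ℕ => P {ω | ∃ i j, δ ≤ |(T : ℝ)⁻¹ * ∑ s ∈ Finset.Icc 1 T, x s ω i * x s ω j -
      momentMatrix P x i j|}) atTop (𝓝 0) := by
  have h1 : Tendsto (fun T : ℕ => ∑ i, ∑ j, P {ω | δ ≤ |(T : ℝ)⁻¹ *
      ∑ s ∈ Finset.Icc 1 T, x s ω i * x s ω j - momentMatrix P x i j|}) atTop (𝓝 0) := by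
    have := tendsto_finsetSum (Finset.univ : Finset (Fin d)) fun i _ =>
      tendsto_finsetSum (Finset.univ : Finset (Fin d)) fun j _ =>
        h.tendsto_measure_average_mul i j hδ
    simpa using this
  refine tendsto_of_tendsto_of_tendsto_of_le_of_le tendsto_const_nhds h1 (fun _ => bot_le)
    fun T => ?_
  rw [Set.ofPred_exists]
  refine (measure_iUnion_fintype_le P _).trans (Finset.sum_le_sum fun i _ => ?_)
  rw [Set.ofPred_exists]
  exact measure_iUnion_fintype_le P _

end Regression

end RenyiRegression

/-! ### Divergence of the statistic and consistency of the test -/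

theorem theorem4p3 {Ω : Type*} [MeasurableSpace Ω] (P : Measure Ω) [IsProbabilityMeasure P] {d : ℕ}
    (x : ℕ → Ω → Fin d → ℝ) (e : ℕ → Ω → ℝ) (σ : ℝ)
    (trim : ℕ → ℝ) (tstar : ℕ → ℕ) (β₁ β₂ : ℕ → Fin d → ℝ)
    (hchange : ∀ᶠ T : ℕ in atTop, 1 < tstar T ∧ tstar T < T ∧ β₁ T ≠ β₂ T)
    (htrim : RenyiRegression.TrimmingAssumption trim)
    (happrox : RenyiRegression.ApproximationAssumption P e σ)
    (hdep : RenyiRegression.DependenceAssumption P x e)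
    (hC : IsUnit (RenyiRegression.momentMatrix P x))
    (hloc : ∀ᶠ T : ℕ in atTop, trim T ≤ (tstar T : ℝ) ∧ (tstar T : ℝ) ≤ (T : ℝ) - trim T)
    (hsize : Tendsto (fun T : ℕ =>
      √(trim T) * |RenyiRegression.meanVec P x ⬝ᵥ (β₁ T - β₂ T)|) atTop atTop)
    (hnorm : (fun T : ℕ => ‖β₁ T - β₂ T‖) =o[atTop] (fun T : ℕ =>
      √(trim T) * |RenyiRegression.meanVec P x ⬝ᵥ (β₁ T - β₂ T)|)) :
    (∀ M : ℝ, Tendsto (fun T : ℕ => P {ω |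
      √(trim T) * RenyiRegression.residualRenyi x e (β₁ T) (β₂ T) (tstar T) T (trim T) ω ≤ M})
      atTop (𝓝 0)) ∧
    (∀ q : ℝ, Tendsto (fun T : ℕ => P {ω |
      q < √(trim T) / σ *
        RenyiRegression.residualRenyi x e (β₁ T) (β₂ T) (tstar T) T (trim T) ω})
      atTop (𝓝 1)) := by
  open RenyiRegression in
  have hdiv : ∀ M : ℝ, Tendsto (fun T : ℕ => P {ω |
      √(trim T) * residualRenyi x e (β₁ T) (β₂ T) (tstar T) T (trim T) ω ≤ M}) atTop (𝓝 0) := by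
    set m := meanVec P x with hm
    obtain ⟨δ, hδ, K, hK, hinv⟩ := exists_abs_inv_apply_le_of_near _ hC
    have hlt : ∀ᶠ T in atTop, tstar T < T := hchange.mono fun T h => h.2.1
    obtain ⟨c, ζ, hc, hζ, hcx⟩ := hdep.exists_moment_centred_le
    obtain ⟨c', ζ', hc', hζ', hce⟩ := hdep.moment_e
    have hx := fun i => bddInProb_sqrt_mul_average_split (P := P)
      (f := fun t ω => x t ω i - m i) (fun t => (hdep.memLp_apply t i).sub (memLp_const _))
      hc hζ (hcx i) htrim.1 hlt hloc
    have he := bddInProb_sqrt_mul_average_split hdep.memLp_e hc' hζ' hce htrim.1 hlt hloc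
    set a : ℕ → Ω → Fin d → ℝ := fun T ω i =>
      1 / (tstar T : ℝ) * ∑ s ∈ Finset.Icc 1 (tstar T), (x s ω i - m i) with ha
    set b : ℕ → Ω → Fin d → ℝ := fun T ω i =>
      1 / ((T : ℝ) - tstar T) * ∑ s ∈ Finset.Icc (tstar T + 1) T, (x s ω i - m i) with hb
    set ea : ℕ → Ω → ℝ := fun T ω =>
      1 / (tstar T : ℝ) * ∑ s ∈ Finset.Icc 1 (tstar T), e s ω with hea
    set eb : ℕ → Ω → ℝ := fun T ω =>
      1 / ((T : ℝ) - tstar T) * ∑ s ∈ Finset.Icc (tstar T + 1) T, e s ω with heb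
    set H : ℕ → Ω → ℝ := fun T ω =>
      ∑ j, ∑ l, (T : ℝ)⁻¹ * ∑ s ∈ Finset.Icc 1 T, |x s ω j * x s ω l| with hH
    set N : ℕ → Ω → ℝ := fun T ω =>
      ∑ j, (T : ℝ)⁻¹ * ∑ s ∈ Finset.Icc 1 T, |x s ω j * e s ω| with hN
    have hHb : BddInProb P H := .sum _ fun j _ => .sum _ fun l _ => hdep.bddInProb_average_mul j l
    have hNb : BddInProb P N := .sum _ fun j _ => hdep.bddInProb_average_mul_error j
    have hab : BddInProb P fun T ω => ∑ i, |√(trim T) * a T ω i| := .sum _ fun i _ => (hx i).1.abs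
    have hbb : BddInProb P fun T ω => ∑ i, |√(trim T) * b T ω i| := .sum _ fun i _ => (hx i).2.abs
    have hKb : BddInProb P fun _ _ => K := .const K
    -- The first `O_P(1)` term collects what is free of `‖Δ‖`, the second what is multiplied by it.
    refine tendsto_measure_le_of_lower_bound hsize hnorm
      ((((hab.add hbb).mul (hKb.mul hNb)).add he.1.abs).add he.2.abs)
      (hab.add ((hab.add hbb).mul (hKb.mul hHb)))
      (tendsto_measure_exists_average_mul hdep hδ) ?_
    filter_upwards [hchange, hloc] with T hT hT' ω hω
    have hgood : ∀ i j, |(Matrix.of fun i j : Fin d =>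
        (T : ℝ)⁻¹ * ∑ s ∈ Finset.Icc 1 T, x s ω i * x s ω j) i j - momentMatrix P x i j| < δ := by
      intro i j
      by_contra! hcon
      exact hω ⟨i, j, hcon⟩
    obtain ⟨hdet, hinvK⟩ := hinv _ hgood
    have hB := abs_leastSquares_sub_le x e (β₁ T) (β₂ T) (k := tstar T)
      (by omega : 0 < T) ω hK hdet hinvK
    -- The location condition says exactly that `t*` is an admissible index of the maximum.
    have hstat := le_renyiStat
      (fun t => residual x (response x e (β₁ T) (β₂ T) (tstar T)) T t ω) hT'.1 hT'.2 hT.2.1.le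
    rw [residual_contrast_eq x e (β₁ T) (β₂ T) m (by omega) hT.2.1 ω] at hstat
    change |m ⬝ᵥ (β₁ T - β₂ T) + a T ω ⬝ᵥ (β₁ T - β₂ T)
      - a T ω ⬝ᵥ (leastSquares x (response x e (β₁ T) (β₂ T) (tstar T)) T ω - β₂ T)
      + b T ω ⬝ᵥ (leastSquares x (response x e (β₁ T) (β₂ T) (tstar T)) T ω - β₂ T)
      + ea T ω - eb T ω| ≤ residualRenyi x e (β₁ T) (β₂ T) (tstar T) T (trim T) ω at hstat
    set Δ := β₁ T - β₂ T with hΔ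
    set θ := leastSquares x (response x e (β₁ T) (β₂ T) (tstar T)) T ω - β₂ T with hθ
    set R := residualRenyi x e (β₁ T) (β₂ T) (tstar T) T (trim T) ω with hR
    have hθb : ∀ i, |θ i| ≤ K * (‖Δ‖ * H T ω + N T ω) := hB
    have hw := Real.sqrt_nonneg (trim T)
    set w := √(trim T) with hwdef
    -- The weight `√t_T` is put on `u`, which is `a` or `b`; the other factor needs only a
    -- coordinatewise bound.
    have hbound : ∀ (u v : Fin d → ℝ) (V : ℝ), (∀ i, |v i| ≤ V) →
        w * |u ⬝ᵥ v| ≤ (∑ i, |w * u i|) * V := by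
      intro u v V hV
      calc w * |u ⬝ᵥ v| ≤ w * ∑ i, |u i| * |v i| :=
            mul_le_mul_of_nonneg_left (abs_dotProduct_le u v) hw
        _ ≤ (∑ i, |w * u i|) * V := by
          rw [Finset.mul_sum, Finset.sum_mul]
          refine Finset.sum_le_sum fun i _ => ?_
          rw [abs_mul, abs_of_nonneg hw, ← mul_assoc]
          exact mul_le_mul_of_nonneg_left (hV i) (by positivity)
    have q1 := hbound (a T ω) Δ ‖Δ‖ (fun i => norm_le_pi_norm Δ i)
    have q2 := hbound (a T ω) θ _ hθb
    have q3 := hbound (b T ω) θ _ hθb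
    have htri : |m ⬝ᵥ Δ| ≤ R + |a T ω ⬝ᵥ Δ| + |a T ω ⬝ᵥ θ| + |b T ω ⬝ᵥ θ| + |ea T ω| + |eb T ω| := by
      refine abs_le.2 ⟨?_, ?_⟩ <;>
      linarith [(abs_le.1 hstat).1, (abs_le.1 hstat).2, neg_abs_le (a T ω ⬝ᵥ Δ),
        le_abs_self (a T ω ⬝ᵥ Δ), neg_abs_le (a T ω ⬝ᵥ θ), le_abs_self (a T ω ⬝ᵥ θ),
        neg_abs_le (b T ω ⬝ᵥ θ), le_abs_self (b T ω ⬝ᵥ θ), neg_abs_le (ea T ω),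
        le_abs_self (ea T ω), neg_abs_le (eb T ω), le_abs_self (eb T ω)]
    have htri' := mul_le_mul_of_nonneg_left htri hw
    set sa := ∑ i, |w * a T ω i| with hsa
    set sb := ∑ i, |w * b T ω i| with hsb
    have hea' : |w * ea T ω| = w * |ea T ω| := by rw [abs_mul, abs_of_nonneg hw]
    have heb' : |w * eb T ω| = w * |eb T ω| := by rw [abs_mul, abs_of_nonneg hw]
    have r1 := le_abs_self (sa + (sa + sb) * (K * H T ω))
    have r2 := le_abs_self ((sa + sb) * (K * N T ω) + |w * ea T ω| + |w * eb T ω|)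
    have r3 := mul_le_mul_of_nonneg_left r1 (norm_nonneg Δ)
    rw [abs_of_nonneg (norm_nonneg Δ)]
    linarith
  refine ⟨hdiv, fun q => ?_⟩
  have hσ : 0 < σ := happrox.1
  have h1 := hdiv (q * σ)
  have h2 : Tendsto (fun T : ℕ => 1 - P {ω | √(trim T) *
      RenyiRegression.residualRenyi x e (β₁ T) (β₂ T) (tstar T) T (trim T) ω ≤ q * σ})
      atTop (𝓝 1) := by
    have := ENNReal.Tendsto.sub (tendsto_const_nhds (x := (1 : ℝ≥0∞))) h1 (Or.inl (by simp))
    simpa using this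
  refine tendsto_of_tendsto_of_tendsto_of_le_of_le h2 tendsto_const_nhds (fun T => ?_)
    fun T => prob_le_one
  -- Subadditivity over the event and its complement gives the lower bound without measurability of
  -- the rejection event.
  rw [tsub_le_iff_right, ← measure_univ (μ := P)]
  refine (measure_mono fun ω _ => ?_).trans (measure_union_le _ _)
  by_cases h : √(trim T) *
      RenyiRegression.residualRenyi x e (β₁ T) (β₂ T) (tstar T) T (trim T) ω ≤ q * σ
  · exact Or.inr h
  · left
    rw [Set.mem_ofPred_eq, div_mul_eq_mul_div, lt_div_iff₀ hσ]
    exact not_le.1 h
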